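/- Let $d\ge 3$ and let $A=C^\infty(\mathbb R^d)$ be the algebra of smooth complex-valued functions on $\mathbb R^d$, with pointwise product $m_0$. A Poisson bivector on $\mathbb R^d$ is an antisymmetric matrix $\mathfrak p=(\mathfrak p^{ij})$ of smooth real-valued functions whose bracket $\{f,g\}=\sum_{i,j}\mathfrak p^{ij}\,\partial_if\,\partial_jg$ satisfies the Jacobi identity on $A$. A star-product in the direction of $\mathfrak p$ is an associative $\mathbb C[[\hbar]]$-bilinear product $m_0+\sum_{k\ge1}\hbar^kc_k$ on $A[[\hbar]]$, where the $c_k$ are bidifferential operators on $\mathbb R^d$ vanishing on constants and $\tfrac12\big(c_1(f,g)-c_1(g,f)\big)=\{f,g\}$ for all $f,g\in A$. For $n,m\ge1$ let $\mathcal K_{n,m}$ be the set of directed graphs, without loops and without multiple edges, having $n$ labelled vertices of type 1, each with exactly two outgoing edges, labelled first and second, and $m$ labelled vertices of type 2, each with no outgoing edge and at least one incoming edge. To $\Gamma\in\mathcal K_{n,m}$ one associates the $m$-differential operator $$B^{\mathfrak p}_\Gamma(f_1,\dots,f_m)=\sum_{I}\ \prod_{v}\Big(\prod_{e\to v}\partial_{I(e)}\Big)\mathfrak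 p^{I(e_v^1)I(e_v^2)}\ \prod_{w=1}^m\Big(\prod_{e\to w}\partial_{I(e)}\Big)f_w ,$$ where $I$ runs over all maps from the set of edges to $\{1,\dots,d\}$, $v$ runs over the vertices of type 1, $e_v^1,e_v^2$ are the first and second edges starting at $v$, and $e\to u$ means that the edge $e$ ends at $u$. An operator is $\mathfrak p$-universal if it is a finite $\mathbb R$-linear combination of operators $B^{\mathfrak p}_\Gamma$, $\Gamma\in\bigcup_{n\ge1}\mathcal K_{n,m}$. A universal quantization formula on $\mathbb R^d$ is a correspondence which sends every Poisson bivector $\mathfrak p$ on $\mathbb R^d$ to a star-product $m_0+\sum_{k\ge1}\hbar^kc_k^{\mathfrak p}$ in the direction of $\mathfrak p$ such that every $c_k^{\mathfrak p}$, $k\ge1$, is $\mathfrak p$-universal. A graph has a wheel if it contains an oriented cycle. **Theorem.** Any universal quantization formula on $\mathbb R^d$, $d\ge3$, involves graphs with wheels: there are a Poisson bivector $\mathfrak p$ and a $k\ge1$ such that, in every expression of $c_k^{\mathfrak p}$ as a finite $\mathbb R$-linear combination $\sum_\Gamma a_\Gamma B^{\mathfrak p}_\Gamma$, $\Gamma\in\bigcup_{n\ge1}\mathcal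 K_{n,2}$, some graph $\Gamma$ with a wheel has a coefficient $a_\Gamma\ne0$. -/

import Mathlib

open scoped ContDiff

noncomputable section

namespace UniversalQuantization

/-- The algebra `A = C^∞(ℝ^d)` of smooth complex-valued functions on `ℝ^d`, with the pointwise
product. Only the smooth structure of `ℝ^d = (Fin d → ℝ)` is used. -/
def smoothSubalgebra (d : ℕ) : Subalgebra ℂ ((Fin d → ℝ) → ℂ) where
  carrier := {f | ContDiff ℝ ∞ f}
  mul_mem' := by
    intro f g hf hg
    exact ContDiff.mul (show ContDiff ℝ ∞ f from hf) (show ContDiff ℝ ∞ g from hg)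
  add_mem' := by
    intro f g hf hg
    exact ContDiff.add (show ContDiff ℝ ∞ f from hf) (show ContDiff ℝ ∞ g from hg)
  algebraMap_mem' := by
    intro r
    exact (contDiff_const : ContDiff ℝ ∞ fun _ : Fin d → ℝ => r)

/-- Smooth complex-valued functions on `ℝ^d`, as a type. -/
abbrev A (d : ℕ) : Type := smoothSubalgebra d

/-- The partial derivative `∂_i` as an operator on `A`. -/
def pderiv {d : ℕ} (i : Fin d) (f : A d) : A d :=
  ⟨fun x => fderiv ℝ f.1 x (Pi.single i 1),
    ((show ContDiff ℝ ∞ f.1 from f.2).fderiv_right (m := ∞) (by simp)).clm_apply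
      contDiff_const⟩

/-- The partial derivative `∂^α = ∂_1^{α_1} ⋯ ∂_d^{α_d}` for a multi-index `α ∈ ℕ^d`. -/
def multiDeriv {d : ℕ} (α : Fin d → ℕ) (f : A d) : A d :=
  (List.finRange d).foldr (fun i g => (pderiv i)^[α i] g) f

/-- The bracket `{f, g} = ∑_{i,j} π^{ij} ∂_i f ∂_j g` attached to a matrix `π` of functions. -/
def bracket {d : ℕ} (π : Fin d → Fin d → A d) (f g : A d) : A d :=
  ∑ i, ∑ j, π i j * pderiv i f * pderiv j g

/-- A smooth real-valued function, seen in `A`. -/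
def ofRealFun {d : ℕ} (u : (Fin d → ℝ) → ℝ) (hu : ContDiff ℝ ∞ u) : A d :=
  ⟨fun x => (u x : ℂ), Complex.ofRealCLM.contDiff.comp hu⟩

/-- A smooth (real) Poisson bivector on `ℝ^d`, given by its components `𝔭^{ij}` in the
coordinates: they are smooth and antisymmetric, and the bracket they define on `A` satisfies the
Jacobi identity. -/
structure PoissonBivector (d : ℕ) where
  comp : Fin d → Fin d → (Fin d → ℝ) → ℝ
  smooth : ∀ i j, ContDiff ℝ ∞ (comp i j)
  antisymm : ∀ i j x, comp j i x = -comp i j x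
  jacobi : ∀ f g h : A d,
    let P : A d → A d → A d := bracket fun i j => ofRealFun (comp i j) (smooth i j)
    P f (P g h) + P g (P h f) + P h (P f g) = 0

/-- The component `𝔭^{ij}` as an element of `A`. -/
def PoissonBivector.coord {d : ℕ} (p : PoissonBivector d) (i j : Fin d) : A d :=
  ofRealFun (p.comp i j) (p.smooth i j)

/-- Maps from `m` functions to functions. -/
abbrev Cochain (d m : ℕ) : Type := (Fin m → A d) → A d

/-- `C ∈ 𝒞^m(A, A)`: `C` is an `m`-differential operator vanishing on constants, i.e. locally it is
a finite sum of terms `C_{α_1⋯α_m} ∂^{α_1} f_1 ⋯ ∂^{α_m} f_m` with smooth coefficients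
and `|α_i| ≥ 1` for every `i`. -/
def IsPolyDiff {d m : ℕ} (C : Cochain d m) : Prop :=
  ∀ x₀ : Fin d → ℝ, ∃ U : Set (Fin d → ℝ), IsOpen U ∧ x₀ ∈ U ∧
    ∃ (S : Finset (Fin m → Fin d → ℕ)) (a : (Fin m → Fin d → ℕ) → (Fin d → ℝ) → ℂ),
      (∀ α ∈ S, ContDiffOn ℝ ∞ (a α) U ∧ ∀ r, α r ≠ 0) ∧
      ∀ (f : Fin m → A d), ∀ x ∈ U,
        (C f).1 x = ∑ α ∈ S, a α x * ∏ r, (multiDeriv (α r) (f r)).1 x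

/-- The product on `A⟦ħ⟧`, bilinear over `ℂ⟦ħ⟧` when all the `c_k` are bilinear over `ℂ`, which is
defined by `∑_k ħ^k c_k`. -/
def starMul {d : ℕ} (c : ℕ → Cochain d 2) (F G : PowerSeries (A d)) : PowerSeries (A d) :=
  PowerSeries.mk fun n => ∑ q ∈ Finset.HasAntidiagonal.antidiagonal n, ∑ r ∈ Finset.HasAntidiagonal.antidiagonal q.2,
    c q.1 ![PowerSeries.coeff r.1 F, PowerSeries.coeff r.2 G]

/-- `∑_k ħ^k c_k` is a star-product in the direction of `𝔭`. -/
structure IsStarProduct {d : ℕ} (p : PoissonBivector d) (c : ℕ → Cochain d 2) : Prop where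
  zero : ∀ f g : A d, c 0 ![f, g] = f * g
  polyDiff : ∀ k, 1 ≤ k → IsPolyDiff (c k)
  assoc : ∀ F G H : PowerSeries (A d), starMul c (starMul c F G) H = starMul c F (starMul c G H)
  antisymm : ∀ f g : A d,
    (1 / 2 : ℂ) • (c 1 ![f, g] - c 1 ![g, f]) = bracket p.coord f g

/-- The graphs in `𝒦_{n,m}` (for `m ≥ 1`): simple directed graphs with vertices `Fin n` of type 1
and `Fin m` of type 2. Every vertex of type 1 has exactly two outgoing edges, labelled `0` and `1`;
`target v e` is the end point of the edge labelled `e` starting at `v`. Vertices of type 2 have no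
outgoing edge and at least one incoming edge; in particular `n ≥ 1` as soon as `m ≥ 1`. -/
structure KGraph (n m : ℕ) where
  target : Fin n → Fin 2 → Fin n ⊕ Fin m
  no_loop : ∀ v e, target v e ≠ Sum.inl v
  no_multiple_edge : ∀ v, target v 0 ≠ target v 1
  indegree_pos : ∀ w : Fin m, ∃ v e, target v e = Sum.inr w

/-- The graph has a wheel: there is an oriented cycle, i.e. a nonempty oriented path from some
vertex to itself. No edge starts at a vertex of type 2, so a cycle runs through vertices of type 1
only. -/
def KGraph.HasWheel {n m : ℕ} (Γ : KGraph n m) : Prop :=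
  ∃ v : Fin n, Relation.TransGen (fun u w => ∃ e, Γ.target u e = Sum.inl w) v v

/-- Given a coordinate index `I v e` on every edge, the multi-index of the derivative acting on the
vertex `t`: its `i`-th entry is the number of edges which end at `t` and carry the index `i`. -/
def KGraph.incoming {n m d : ℕ} (Γ : KGraph n m) (I : Fin n → Fin 2 → Fin d) (t : Fin n ⊕ Fin m)
    (i : Fin d) : ℕ :=
  (Finset.univ.filter fun q : Fin n × Fin 2 => Γ.target q.1 q.2 = t ∧ I q.1 q.2 = i).card

/-- The polydifferential operator `B^𝔭_Γ`: sum over all ways to put coordinate indices on the edges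
of the product of the components `𝔭^{ij}` at the vertices of type 1 and of the functions `f_w` at
the vertices of type 2, each differentiated along its incoming edges. -/
def KGraph.B {n m d : ℕ} (p : PoissonBivector d) (Γ : KGraph n m) : Cochain d m := fun f =>
  ∑ I : Fin n → Fin 2 → Fin d,
    (∏ v : Fin n, multiDeriv (Γ.incoming I (Sum.inl v)) (p.coord (I v 0) (I v 1))) *
      ∏ w : Fin m, multiDeriv (Γ.incoming I (Sum.inr w)) (f w)

/-- The finite real linear combination `∑_n ∑_{Γ ∈ 𝒦_{n,m}} a_Γ B^𝔭_Γ`. -/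
def graphSum {d m : ℕ} (p : PoissonBivector d) (a : (Σ n, KGraph n m) →₀ ℝ) : Cochain d m :=
  a.sum fun Γ r => (r : ℂ) • Γ.2.B p

/-- `𝔭`-universal cochains. -/
def IsUniversal {d m : ℕ} (p : PoissonBivector d) (C : Cochain d m) : Prop :=
  ∃ a : (Σ n, KGraph n m) →₀ ℝ, C = graphSum p a

/-- A universal quantization formula on `ℝ^d`: a correspondence which sends every Poisson bivector
`𝔭` to a star-product `m_0 + ∑_{k ≥ 1} ħ^k c_k^𝔭` in the direction of `𝔭`, all of whose
coefficients `c_k^𝔭`, `k ≥ 1`, are `𝔭`-universal. -/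
structure UniversalQuantizationFormula (d : ℕ) where
  c : PoissonBivector d → ℕ → Cochain d 2
  isStarProduct : ∀ p, IsStarProduct p (c p)
  universal : ∀ p k, 1 ≤ k → IsUniversal p (c p k)

end UniversalQuantization

end

open scoped ContDiff

noncomputable section

namespace UniversalQuantization

/-! ### Partial derivatives and functions of one linear form -/

section

variable {d : ℕ}

/-! Without wheels, a star-product is too rigid to exist for the bracket `{x, y} = x²`, `{y, z} =
xz`, `{z, x} = xy²` in three of the coordinates. A graph without wheel has a type 1 vertex whose two
edges end at the two type 2 vertices. If both arguments are functions of the same linear form,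
exchanging the indices on these two edges changes the sign of the term, by antisymmetry of `𝔭`, so
the operator vanishes (`KGraph.B_jet_eq_zero`). Hence star powers of a linear form are its ordinary
powers. On two coordinate functions, only the graph with a single type 1 vertex survives
(`KGraph.exists_B_coordFn`), so every `c_k` gives a multiple of `𝔭^{ij}`.

It follows (`StarAlgebra.exists_commutator`) that `[x_i, x_j] = H 𝔭^{ij}` in the star algebra, where
`H = 2ħ + ⋯` has scalar coefficients, hence is central and can be cancelled, and that `xz` and, by
polarization of cubes, `xy²` are the symmetrized star products. The Jacobi identity for commutators
of `x, y, z` holds at the classical level but leaves a term of higher order in `H`, which forces `2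
x⁴ = 0` (`two_mul_pow_eq_zero_of_commutators`), a contradiction. -/

theorem A.contDiff (f : A d) : ContDiff ℝ ∞ f.1 := f.2

theorem A.differentiableAt (f : A d) (x : Fin d → ℝ) : DifferentiableAt ℝ f.1 x :=
  (f.contDiff.differentiable (by simp)).differentiableAt

theorem A.neg_mul (f g : A d) : -f * g = -(f * g) := by ring

theorem A.smul_neg (c : ℂ) (f : A d) : c • -f = -(c • f) :=
  Subtype.ext (_root_.smul_neg c f.1)

theorem pderiv_apply (i : Fin d) (f : A d) (x : Fin d → ℝ) :
    (pderiv i f).1 x = fderiv ℝ f.1 x (Pi.single i 1) := rfl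

theorem pderiv_add (i : Fin d) (f g : A d) : pderiv i (f + g) = pderiv i f + pderiv i g := by
  ext x
  change fderiv ℝ (f.1 + g.1) x _ = fderiv ℝ f.1 x _ + fderiv ℝ g.1 x _
  rw [fderiv_add (f.differentiableAt x) (g.differentiableAt x)]
  rfl

theorem pderiv_smul (i : Fin d) (c : ℂ) (f : A d) : pderiv i (c • f) = c • pderiv i f := by
  ext x
  change fderiv ℝ (c • f.1) x _ = c • fderiv ℝ f.1 x _
  rw [fderiv_const_smul (f.differentiableAt x)]
  rfl

theorem pderiv_mul (i : Fin d) (f g : A d) :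
    pderiv i (f * g) = pderiv i f * g + f * pderiv i g := by
  ext x
  change fderiv ℝ (f.1 * g.1) x _ = fderiv ℝ f.1 x _ * g.1 x + f.1 x * fderiv ℝ g.1 x _
  rw [fderiv_mul (f.differentiableAt x) (g.differentiableAt x)]
  simp only [add_apply, smul_apply, smul_eq_mul]
  ring

theorem pderiv_comm (i j : Fin d) (f : A d) : pderiv i (pderiv j f) = pderiv j (pderiv i f) := by
  have key (i j : Fin d) (x : Fin d → ℝ) : (pderiv i (pderiv j f)).1 x =
      fderiv ℝ (fderiv ℝ f.1) x (Pi.single i 1) (Pi.single j 1) := by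
    have hd : DifferentiableAt ℝ (fderiv ℝ f.1) x :=
      ((f.contDiff.fderiv_right (m := ∞) (by simp)).differentiable (by simp)).differentiableAt
    change fderiv ℝ (fun y => fderiv ℝ f.1 y (Pi.single j 1)) x (Pi.single i 1) = _
    rw [fderiv_clm_apply hd (differentiableAt_const _)]
    simp
  ext x
  rw [key, key]
  have hs : IsSymmSndFDerivAt ℝ f.1 x :=
    (f.contDiff.contDiffAt).isSymmSndFDerivAt (by
      simp only [minSmoothness_of_isRCLikeNormedField]; exact WithTop.coe_le_coe.2 le_top)
  exact hs _ _

/-- The partial derivative as a linear map. -/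
def pderivₗ (i : Fin d) : A d →ₗ[ℂ] A d where
  toFun := pderiv i
  map_add' := pderiv_add i
  map_smul' := pderiv_smul i

theorem multiDeriv_eq_foldr (α : Fin d → ℕ) (f : A d) :
    multiDeriv α f = (List.finRange d).foldr (fun i g => ((pderivₗ i) ^ (α i)) g) f := by
  simp only [multiDeriv, Module.End.pow_apply]
  rfl

theorem pderiv_zero (i : Fin d) : pderiv i (0 : A d) = 0 := map_zero (pderivₗ i)

/-- The operator `∂^α` as a linear map. -/
def multiDerivₗ (α : Fin d → ℕ) : A d →ₗ[ℂ] A d where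
  toFun := multiDeriv α
  map_add' f g := by
    simp only [multiDeriv_eq_foldr]
    induction List.finRange d with
    | nil => rfl
    | cons i l ih => simp only [List.foldr_cons, ih, map_add]
  map_smul' c f := by
    simp only [multiDeriv_eq_foldr, RingHom.id_apply]
    induction List.finRange d with
    | nil => rfl
    | cons i l ih => simp only [List.foldr_cons, ih, map_smul]

theorem multiDerivₗ_apply (α : Fin d → ℕ) (f : A d) : multiDerivₗ α f = multiDeriv α f := rfl

theorem multiDeriv_neg (α : Fin d → ℕ) (f : A d) : multiDeriv α (-f) = -multiDeriv α f :=
  map_neg (multiDerivₗ α) f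

theorem multiDeriv_zero_left (f : A d) : multiDeriv (0 : Fin d → ℕ) f = f := by
  unfold multiDeriv
  induction List.finRange d with
  | nil => rfl
  | cons i l ih => simp

/-- `F` is the sequence of successive derivatives of a function of one variable, composed with a
linear form with coefficients `c`. -/
def IsJetAlong (c : Fin d → ℂ) (F : ℕ → A d) : Prop :=
  ∀ n i, pderiv i (F n) = c i • F (n + 1)

theorem IsJetAlong.iterate {c : Fin d → ℂ} {F : ℕ → A d} (hF : IsJetAlong c F) (i : Fin d)
    (k n : ℕ) : (pderiv i)^[k] (F n) = c i ^ k • F (n + k) := by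
  induction k with
  | zero => simp
  | succ k ih =>
    rw [Function.iterate_succ_apply', ih, pderiv_smul, hF, smul_smul, pow_succ, add_assoc]

/-- Chain rule: the multi-index enters only through a scalar monomial in the coefficients of the
linear form and through its total order. -/
theorem IsJetAlong.multiDeriv {c : Fin d → ℂ} {F : ℕ → A d} (hF : IsJetAlong c F)
    (α : Fin d → ℕ) : multiDeriv α (F 0) = (∏ i, c i ^ α i) • F (∑ i, α i) := by
  have key (l : List (Fin d)) : l.foldr (fun i g => (pderiv i)^[α i] g) (F 0) =
      (l.map fun i => c i ^ α i).prod • F (l.map α).sum := by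
    induction l with
    | nil => simp
    | cons i l ih =>
      have hs (k : ℕ) (z : ℂ) (g : A d) : (pderiv i)^[k] (z • g) = z • (pderiv i)^[k] g := by
        induction k with
        | zero => rfl
        | succ k ih => rw [Function.iterate_succ_apply', Function.iterate_succ_apply', ih,
            pderiv_smul]
      rw [List.foldr_cons, ih, hs, hF.iterate, smul_smul, List.map_cons, List.prod_cons,
        List.map_cons, List.sum_cons, add_comm (α i), mul_comm]
  rw [UniversalQuantization.multiDeriv, key, ← List.ofFn_eq_map, List.prod_ofFn,
    ← List.ofFn_eq_map, List.sum_ofFn]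

/-- The coordinate function `x_i`. -/
def coordFn (i : Fin d) : A d :=
  ofRealFun (fun x => x i) (contDiff_apply ℝ ℝ i)

theorem coordFn_apply (i : Fin d) (x : Fin d → ℝ) : (coordFn i).1 x = (x i : ℂ) := rfl

theorem pderiv_coordFn (i j : Fin d) : pderiv i (coordFn j) = if i = j then 1 else 0 := by
  ext x
  have h : HasFDerivAt (coordFn j).1 (Complex.ofRealCLM.comp (ContinuousLinearMap.proj j)) x :=
    (Complex.ofRealCLM.comp (ContinuousLinearMap.proj (R := ℝ) (φ := fun _ : Fin d => ℝ) j)).hasFDerivAt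
  rw [pderiv_apply, h.fderiv]
  by_cases hij : i = j
  · subst hij
    simp
  · simp [hij, Ne.symm hij]

theorem pderiv_one (i : Fin d) : pderiv i (1 : A d) = 0 := by
  ext x
  change fderiv ℝ (fun _ => (1 : ℂ)) x _ = 0
  simp

/-- Jet of a constant. -/
theorem isJetAlong_const (c : Fin d → ℂ) (z : ℂ) :
    IsJetAlong c (fun n => if n = 0 then z • (1 : A d) else 0) := by
  intro n i
  cases n with
  | zero => simp [pderiv_smul, pderiv_one]
  | succ n => simp [pderiv_zero]

theorem multiDeriv_const {α : Fin d → ℕ} (hα : α ≠ 0) (z : ℂ) :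
    multiDeriv α (z • (1 : A d)) = 0 := by
  have h := (isJetAlong_const (fun _ : Fin d => (1 : ℂ)) z).multiDeriv α
  have h0 : ∑ i, α i ≠ 0 := by
    intro h0
    exact hα (funext fun i => by simpa using (Finset.sum_eq_zero_iff.mp h0) i (Finset.mem_univ i))
  simpa [h0] using h

/-- Jet of a power of a linear form. -/
theorem isJetAlong_pow {c : Fin d → ℂ} {l : A d} (hl : ∀ i, pderiv i l = c i • (1 : A d)) (m : ℕ) :
    IsJetAlong c (fun n => (m.descFactorial n : ℂ) • l ^ (m - n)) := by
  have hp (k : ℕ) (i : Fin d) : pderiv i (l ^ k) = c i • (k : ℂ) • l ^ (k - 1) := by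
    induction k with
    | zero => simp [pderiv_one]
    | succ k ih =>
      rw [pow_succ, pderiv_mul, ih, hl]
      cases k with
      | zero => simp
      | succ k =>
        simp only [Nat.add_sub_cancel, pow_succ, smul_mul_assoc, mul_smul_comm, mul_one,
          ← smul_add]
        congr 1
        push_cast
        module
  intro n i
  dsimp only
  rw [pderiv_smul, hp, smul_comm, smul_smul, Nat.descFactorial_succ, Nat.sub_sub]
  simp only [smul_smul]
  congr 1
  push_cast
  ring

end

/-! ### Graphs without wheels and their operators -/

section

variable {d n m : ℕ}

namespace KGraph

/-- Absence of wheels makes reachability irreflexive. Being also transitive, on a finite set it is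
well-founded, and a minimal element of `s` is the vertex sought. -/
theorem exists_sink (Γ : KGraph n m) (hΓ : ¬ Γ.HasWheel) (s : Finset (Fin n)) (hs : s.Nonempty) :
    ∃ v ∈ s, ∀ e u, Γ.target v e = Sum.inl u → u ∉ s := by
  let R : Fin n → Fin n → Prop :=
    fun w u => Relation.TransGen (fun u w => ∃ e, Γ.target u e = Sum.inl w) u w
  have : IsTrans (Fin n) R := ⟨fun _ _ _ hab hbc => hbc.trans hab⟩
  have : Std.Irrefl R := ⟨fun v hv => hΓ ⟨v, hv⟩⟩
  obtain ⟨v, hv, hmin⟩ := (Finite.wellFounded_of_trans_of_irrefl R).has_min (s : Set (Fin n)) hs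
  exact ⟨v, hv, fun e u hu hus => hmin u hus (Relation.TransGen.single ⟨e, hu⟩)⟩

/-- A graph without wheel has a vertex of type 1 whose two edges end at vertices of type 2. -/
theorem exists_last (Γ : KGraph n 2) (hΓ : ¬ Γ.HasWheel) :
    ∃ v, ∃ w : Fin 2 → Fin 2, Function.Bijective w ∧ ∀ e, Γ.target v e = Sum.inr (w e) := by
  obtain ⟨v₀, -⟩ := Γ.indegree_pos 0
  obtain ⟨v, -, hv⟩ := Γ.exists_sink hΓ Finset.univ ⟨v₀, Finset.mem_univ _⟩
  have h (e : Fin 2) : ∃ w, Γ.target v e = Sum.inr w := by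
    rcases ht : Γ.target v e with u | w
    · exact absurd (Finset.mem_univ u) (hv e u ht)
    · exact ⟨w, rfl⟩
  choose w hw using h
  refine ⟨v, w, Finite.injective_iff_bijective.mp ?_, hw⟩
  have h01 : w 0 ≠ w 1 := fun h => Γ.no_multiple_edge v (by rw [hw, hw, h])
  intro a b hab
  fin_cases a <;> fin_cases b <;> simp_all

/-- Number of edges which end at `t`. -/
def indegree (Γ : KGraph n m) (t : Fin n ⊕ Fin m) : ℕ :=
  (Finset.univ.filter fun q : Fin n × Fin 2 => Γ.target q.1 q.2 = t).card

theorem sum_incoming (Γ : KGraph n m) (I : Fin n → Fin 2 → Fin d) (t : Fin n ⊕ Fin m) :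
    ∑ i, Γ.incoming I t i = Γ.indegree t := by
  rw [indegree, Finset.card_eq_sum_card_fiberwise (f := fun q => I q.1 q.2) (t := Finset.univ)
    (by simp)]
  simp only [incoming, Finset.filter_filter]

theorem prod_pow_incoming (Γ : KGraph n m) (I : Fin n → Fin 2 → Fin d) (t : Fin n ⊕ Fin m)
    (c : Fin d → ℂ) :
    ∏ i, c i ^ Γ.incoming I t i =
      ∏ q : Fin n × Fin 2 with Γ.target q.1 q.2 = t, c (I q.1 q.2) := by
  rw [← Finset.prod_fiberwise _ (fun q : Fin n × Fin 2 => I q.1 q.2)]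
  refine Finset.prod_congr rfl fun i _ => ?_
  rw [Finset.filter_filter, incoming]
  rw [Finset.prod_congr rfl (g := fun _ => c i) fun q hq => by rw [(Finset.mem_filter.mp hq).2.2]]
  simp

theorem prod_prod_pow_incoming (Γ : KGraph n m) (I : Fin n → Fin 2 → Fin d) (c : Fin d → ℂ) :
    ∏ w, ∏ i, c i ^ Γ.incoming I (Sum.inr w) i =
      ∏ v, ∏ e, if (Γ.target v e).isRight then c (I v e) else 1 := by
  simp_rw [prod_pow_incoming, Finset.prod_filter]
  rw [Finset.prod_comm, Fintype.prod_prod_type]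
  refine Finset.prod_congr rfl fun v _ => Finset.prod_congr rfl fun e _ => ?_
  cases h : Γ.target v e <;> simp

/-- The indices on edges into type 2 vertices leave only a product of scalars `c (I v e)`, while the
derivatives of the arguments depend on the indegrees alone. This form makes the symmetry under
`swapAt` visible. -/
theorem B_jet (p : PoissonBivector d) (Γ : KGraph n m) {c : Fin d → ℂ} {F : Fin m → ℕ → A d}
    (hF : ∀ w, IsJetAlong c (F w)) :
    Γ.B p (fun w => F w 0) = ∑ I : Fin n → Fin 2 → Fin d,
      (∏ v, ∏ e, if (Γ.target v e).isRight then c (I v e) else 1) •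
      ((∏ v, multiDeriv (Γ.incoming I (Sum.inl v)) (p.coord (I v 0) (I v 1))) *
        ∏ w, F w (Γ.indegree (Sum.inr w))) := by
  unfold B
  refine Finset.sum_congr rfl fun I _ => ?_
  simp_rw [(hF _).multiDeriv, sum_incoming]
  rw [← prod_prod_pow_incoming, ← mul_smul_comm, Finset.prod_smul]

/-- Exchange of the two indices on the edges starting at `v`. -/
def swapAt (v : Fin n) : Equiv.Perm (Fin n → Fin 2 → Fin d) :=
  Function.Involutive.toPerm (fun I => Function.update I v (I v ∘ Equiv.swap 0 1)) <| by
    intro I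
    ext u e
    by_cases hu : u = v
    · subst hu; simp
    · simp [hu]

theorem swapAt_apply_self (v : Fin n) (I : Fin n → Fin 2 → Fin d) (e : Fin 2) :
    swapAt v I v e = I v (Equiv.swap 0 1 e) := by
  change Function.update I v (I v ∘ Equiv.swap 0 1) v e = _
  rw [Function.update_self]
  rfl

theorem swapAt_apply_of_ne {u v : Fin n} (h : u ≠ v) (I : Fin n → Fin 2 → Fin d) :
    swapAt v I u = I u :=
  Function.update_of_ne h _ _

theorem _root_.UniversalQuantization.PoissonBivector.coord_swap (p : PoissonBivector d)
    (i j : Fin d) : p.coord j i = -p.coord i j := by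
  ext x
  change ((p.comp j i x : ℝ) : ℂ) = -((p.comp i j x : ℝ) : ℂ)
  rw [p.antisymm i j x]
  push_cast
  rfl

/-- At a vertex `v` with both edges ending at type 2 vertices, `swapAt v` permutes the labellings
`I`. It fixes the scalar factor and all other vertices, and changes the sign of the factor at `v`.
So the sum equals its own negative. -/
theorem B_jet_eq_zero (p : PoissonBivector d) (Γ : KGraph n 2) (hΓ : ¬ Γ.HasWheel)
    {c : Fin d → ℂ} {F : Fin 2 → ℕ → A d} (hF : ∀ w, IsJetAlong c (F w)) :
    Γ.B p (fun w => F w 0) = 0 := by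
  obtain ⟨v, w, -, hw⟩ := Γ.exists_last hΓ
  rw [Γ.B_jet p hF]
  have torsion (f : A d) (h : f = -f) : f = 0 := by
    ext x
    exact self_eq_neg.mp (congrArg (fun g : A d => g.1 x) h)
  refine torsion _ ?_
  conv_lhs => rw [← Equiv.sum_comp (swapAt v)]
  rw [← Finset.sum_neg_distrib]
  refine Finset.sum_congr rfl fun I _ => ?_
  -- No edge from `v` ends at a type 1 vertex, so the derivatives acting on the bivector are
  -- unchanged.
  have hinc (u : Fin n) : Γ.incoming (swapAt v I) (Sum.inl u) = Γ.incoming I (Sum.inl u) := by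
    ext i
    unfold incoming
    congr 1
    refine Finset.filter_congr fun q _ => and_congr_right fun hq => ?_
    have hqv : q.1 ≠ v := by
      rintro h
      rw [h, hw] at hq
      cases hq
    rw [swapAt_apply_of_ne hqv]
  have hc : (∏ u, ∏ e, if (Γ.target u e).isRight then c (swapAt v I u e) else 1) =
      ∏ u, ∏ e, if (Γ.target u e).isRight then c (I u e) else 1 := by
    refine Finset.prod_congr rfl fun u _ => ?_
    by_cases hu : u = v
    · subst hu
      simp [hw, swapAt_apply_self, mul_comm]
    · rw [swapAt_apply_of_ne hu]
  have hp : (∏ u, multiDeriv (Γ.incoming I (Sum.inl u))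
        (p.coord (swapAt v I u 0) (swapAt v I u 1))) =
      -∏ u, multiDeriv (Γ.incoming I (Sum.inl u)) (p.coord (I u 0) (I u 1)) := by
    rw [← Finset.mul_prod_erase _ _ (Finset.mem_univ v),
      ← Finset.mul_prod_erase _ (fun u => multiDeriv _ (p.coord (I u 0) (I u 1)))
        (Finset.mem_univ v)]
    refine Eq.trans ?_ (A.neg_mul _ _)
    congr 1
    · rw [swapAt_apply_self, swapAt_apply_self, Equiv.swap_apply_left, Equiv.swap_apply_right,
        p.coord_swap, multiDeriv_neg]
    · refine Finset.prod_congr rfl fun u hu => ?_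
      rw [swapAt_apply_of_ne (Finset.ne_of_mem_erase hu)]
  simp_rw [hinc]
  rw [hc, hp, A.neg_mul, A.smul_neg]

theorem isJetAlong_coordFn (i : Fin d) :
    IsJetAlong (fun k => if k = i then 1 else 0)
      (fun n => if n = 0 then coordFn i else if n = 1 then 1 else 0) := by
  intro n k
  match n with
  | 0 => simp [pderiv_coordFn]
  | 1 => simp [pderiv_one]
  | n + 2 => simp [pderiv_zero]

theorem multiDeriv_coordFn (α : Fin d → ℕ) (i : Fin d) :
    multiDeriv α (coordFn i) = if α = Pi.single i 1 then 1 else if α = 0 then coordFn i else 0 := by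
  have h := (isJetAlong_coordFn i).multiDeriv α
  simp only [if_true] at h
  rw [h]
  by_cases hα : ∀ k, k ≠ i → α k = 0
  · have h1 : α = Pi.single i (α i) := by
      ext k
      by_cases hk : k = i
      · subst hk; simp
      · simp [hk, hα k hk]
    have h2 : (∏ k, (if k = i then (1 : ℂ) else 0) ^ α k) = 1 :=
      Finset.prod_eq_one fun k _ => by
        by_cases hk : k = i
        · simp [hk]
        · simp [hα k hk]
    have h3 : ∑ k, α k = α i := by
      rw [h1]; simp
    rw [h2, h3, one_smul]
    generalize α i = a at *
    subst h1
    rcases a with _ | _ | a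
    · rw [if_pos rfl, Pi.single_zero, if_neg, if_pos rfl]
      intro h
      simpa using congrFun h i
    · simp
    · rw [if_neg (by omega), if_neg (by omega), if_neg, if_neg]
      · intro h
        simpa using congrFun h i
      · intro h
        simpa using congrFun h i
  · push Not at hα
    obtain ⟨k, hk, hk0⟩ := hα
    have h2 : (∏ k, (if k = i then (1 : ℂ) else 0) ^ α k) = 0 :=
      Finset.prod_eq_zero (Finset.mem_univ k) (by simp [hk, hk0])
    have h3 : α ≠ Pi.single i 1 := fun h => hk0 (by simp [h, hk])
    have h4 : α ≠ 0 := fun h => hk0 (by simp [h])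
    rw [h2, zero_smul, if_neg h3, if_neg h4]

theorem eq_of_target_eq_inr (Γ : KGraph n 2) (h1 : ∀ w, Γ.indegree (Sum.inr w) ≤ 1)
    {v u : Fin n} {e e' : Fin 2} {w : Fin 2} (hv : Γ.target v e = Sum.inr w)
    (hu : Γ.target u e' = Sum.inr w) : u = v ∧ e' = e := by
  have := Finset.card_le_one.mp (h1 w) (u, e') (by simpa using hu) (v, e) (by simpa using hv)
  simpa using this

/-- The last vertex `z` uses up the only edges allowed into type 2 vertices. A last vertex among the
remaining ones would have to send both edges to `z`, a forbidden double edge. -/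
theorem eq_one_of_indegree_le_one (Γ : KGraph n 2) (hΓ : ¬ Γ.HasWheel)
    (h1 : ∀ w, Γ.indegree (Sum.inr w) ≤ 1) (v u : Fin n) : u = v := by
  obtain ⟨z, w, hw, hz⟩ := Γ.exists_last hΓ
  suffices h : ∀ u, u = z from (h u).trans (h v).symm
  intro u
  by_contra hu
  obtain ⟨y, hy, hy'⟩ := Γ.exists_sink hΓ (Finset.univ.erase z) ⟨u, by simpa using hu⟩
  have hyz : y ≠ z := by simpa using hy
  have ht (e : Fin 2) : Γ.target y e = Sum.inl z := by
    rcases he : Γ.target y e with x | x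
    · have := hy' e x he
      simp only [Finset.mem_erase, Finset.mem_univ, and_true, not_not] at this
      rw [this]
    · obtain ⟨e', rfl⟩ := hw.2 x
      exact absurd (Γ.eq_of_target_eq_inr h1 (hz e') he).1 hyz
  exact Γ.no_multiple_edge y ((ht 0).trans (ht 1).symm)

/-- On coordinate functions, a graph without wheel acts as a multiple of the bivector. -/
theorem exists_B_coordFn (p : PoissonBivector d) (Γ : KGraph n 2) (hΓ : ¬ Γ.HasWheel) :
    ∃ r : ℝ, ∀ i j, Γ.B p ![coordFn i, coordFn j] = (r : ℂ) • p.coord i j := by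
  by_cases h1 : ∀ w, Γ.indegree (Sum.inr w) ≤ 1
  · obtain ⟨z, w, hw, hz⟩ := Γ.exists_last hΓ
    have hn (u : Fin n) : u = z := Γ.eq_one_of_indegree_le_one hΓ h1 z u
    have hinl (I : Fin n → Fin 2 → Fin d) (u : Fin n) : Γ.incoming I (Sum.inl u) = 0 := by
      ext i
      simp only [incoming, Pi.zero_apply, Finset.card_eq_zero, Finset.filter_eq_empty_iff,
        Finset.mem_univ, true_implies]
      rintro ⟨v, e⟩ ⟨hv, -⟩
      have hv : Γ.target v e = Sum.inl u := hv
      rw [hn v, hz] at hv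
      cases hv
    have hinr (I : Fin n → Fin 2 → Fin d) (e : Fin 2) :
        Γ.incoming I (Sum.inr (w e)) = Pi.single (I z e) 1 := by
      ext i
      rw [incoming]
      by_cases hi : I z e = i
      · subst hi
        rw [Pi.single_eq_same, Finset.card_eq_one]
        refine ⟨(z, e), ?_⟩
        ext ⟨v, e'⟩
        simp only [Finset.mem_filter, Finset.mem_univ, true_and, Finset.mem_singleton,
          Prod.mk.injEq]
        constructor
        · rintro ⟨h, -⟩
          exact Γ.eq_of_target_eq_inr h1 (hz e) h
        · rintro ⟨rfl, rfl⟩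
          exact ⟨hz _, rfl⟩
      · rw [Pi.single_eq_of_ne (Ne.symm hi), Finset.card_eq_zero, Finset.filter_eq_empty_iff]
        rintro ⟨v, e'⟩ - ⟨h, h'⟩
        obtain ⟨h2, h3⟩ := Γ.eq_of_target_eq_inr h1 (hz e) h
        exact hi (by rw [← h2, ← h3]; exact h')
    have hB (f : Fin 2 → Fin d) :
        Γ.B p (fun w => coordFn (f w)) = p.coord (f (w 0)) (f (w 1)) := by
      unfold B
      -- A first derivative of a coordinate function is nonzero only in its own direction, which
      -- determines the index on each edge.
      rw [Finset.sum_eq_single (fun _ e => f (w e))]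
      · have hprod : (∏ v : Fin n, multiDeriv (Γ.incoming (fun _ e => f (w e)) (Sum.inl v))
            (p.coord (f (w 0)) (f (w 1)))) = p.coord (f (w 0)) (f (w 1)) := by
          rw [Finset.prod_eq_single z (fun u _ hu => absurd (hn u) hu) (by simp), hinl,
            multiDeriv_zero_left]
        rw [hprod, ← hw.prod_comp]
        simp [hinr, multiDeriv_coordFn]
      · intro I _ hI
        have : ∃ e, I z e ≠ f (w e) := by
          by_contra! h
          exact hI (funext fun u => funext fun e => by rw [hn u, h])
        obtain ⟨e, he⟩ := this
        rw [Finset.prod_eq_zero (i := w e) (Finset.mem_univ _), mul_zero]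
        rw [hinr, multiDeriv_coordFn, if_neg, if_neg]
        · simp
        · intro h
          exact he (by simpa [Pi.single_apply] using congrFun h (I z e))
      · simp
    have hf (i j : Fin d) : (fun w => coordFn (![i, j] w)) = ![coordFn i, coordFn j] := by
      ext w
      fin_cases w <;> rfl
    by_cases hw0 : w 0 = 0
    · have hw1 : w 1 = 1 := by
        have := hw.1.ne (show (1 : Fin 2) ≠ 0 by decide)
        omega
      refine ⟨1, fun i j => ?_⟩
      rw [← hf, hB, hw0, hw1]
      simp
    · have hw0' : w 0 = 1 := by omega
      have hw1 : w 1 = 0 := by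
        have := hw.1.ne (show (1 : Fin 2) ≠ 0 by decide)
        omega
      refine ⟨-1, fun i j => ?_⟩
      rw [← hf, hB, hw0', hw1, p.coord_swap]
      simp
  -- A type 2 vertex with at least two incoming edges differentiates a coordinate function at least
  -- twice, so every term vanishes.
  · push Not at h1
    obtain ⟨w, hw⟩ := h1
    refine ⟨0, fun i j => ?_⟩
    rw [Complex.ofReal_zero, zero_smul]
    refine Finset.sum_eq_zero fun I _ => ?_
    rw [Finset.prod_eq_zero (i := w) (Finset.mem_univ _), mul_zero]
    have hs := Γ.sum_incoming I (Sum.inr w)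
    have key (k : Fin d) : multiDeriv (Γ.incoming I (Sum.inr w)) (coordFn k) = 0 := by
      rw [multiDeriv_coordFn, if_neg, if_neg]
      · intro h
        simp [h] at hs
        omega
      · intro h
        simp [h] at hs
        omega
    fin_cases w <;> exact key _

end KGraph

section Universal

variable (p : PoissonBivector d)

theorem graphSum_jet_eq_zero {a : (Σ n, KGraph n 2) →₀ ℝ} (ha : ∀ Γ ∈ a.support, ¬ Γ.2.HasWheel)
    {c : Fin d → ℂ} {F : Fin 2 → ℕ → A d} (hF : ∀ w, IsJetAlong c (F w)) :
    graphSum p a (fun w => F w 0) = 0 := by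
  rw [graphSum, Finsupp.sum, Finset.sum_apply]
  refine Finset.sum_eq_zero fun Γ hΓ => ?_
  rw [Pi.smul_apply, Γ.2.B_jet_eq_zero p (ha Γ hΓ) hF, smul_zero]

theorem exists_graphSum_coordFn {a : (Σ n, KGraph n 2) →₀ ℝ}
    (ha : ∀ Γ ∈ a.support, ¬ Γ.2.HasWheel) :
    ∃ r : ℂ, ∀ i j, graphSum p a ![coordFn i, coordFn j] = r • p.coord i j := by
  choose! r hr using fun (Γ : Σ n, KGraph n 2) (hΓ : Γ ∈ a.support) => Γ.2.exists_B_coordFn p (ha Γ hΓ)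
  refine ⟨∑ Γ ∈ a.support, (a Γ : ℂ) * (r Γ : ℂ), fun i j => ?_⟩
  rw [graphSum, Finsupp.sum, Finset.sum_apply, Finset.sum_smul]
  refine Finset.sum_congr rfl fun Γ hΓ => ?_
  rw [Pi.smul_apply, hr Γ hΓ, smul_smul]

end Universal

end

/-! ### The ring defined by a star-product -/

section

variable {d : ℕ}

section PolyDiff

variable {C : Cochain d 2}

theorem IsPolyDiff.add_left (hC : IsPolyDiff C) (f f' g : A d) :
    C ![f + f', g] = C ![f, g] + C ![f', g] := by
  ext x
  obtain ⟨U, -, hx, S, a, -, h⟩ := hC x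
  change (C ![f + f', g]).1 x = (C ![f, g]).1 x + (C ![f', g]).1 x
  rw [h _ x hx, h _ x hx, h _ x hx, ← Finset.sum_add_distrib]
  refine Finset.sum_congr rfl fun α _ => ?_
  simp only [Fin.prod_univ_two, Matrix.cons_val_zero, Matrix.cons_val_one]
  rw [← multiDerivₗ_apply, map_add]
  simp only [multiDerivₗ_apply]
  exact (congrArg (a α x * ·) (add_mul _ _ _)).trans (mul_add _ _ _)

theorem IsPolyDiff.add_right (hC : IsPolyDiff C) (f g g' : A d) :
    C ![f, g + g'] = C ![f, g] + C ![f, g'] := by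
  ext x
  obtain ⟨U, -, hx, S, a, -, h⟩ := hC x
  change (C ![f, g + g']).1 x = (C ![f, g]).1 x + (C ![f, g']).1 x
  rw [h _ x hx, h _ x hx, h _ x hx, ← Finset.sum_add_distrib]
  refine Finset.sum_congr rfl fun α _ => ?_
  simp only [Fin.prod_univ_two, Matrix.cons_val_zero, Matrix.cons_val_one]
  rw [← multiDerivₗ_apply (α 1) (g + g'), map_add]
  simp only [multiDerivₗ_apply]
  exact (congrArg (a α x * ·) (mul_add _ _ _)).trans (mul_add _ _ _)

theorem IsPolyDiff.eq_zero_of_const (hC : IsPolyDiff C) {f : Fin 2 → A d} {r : Fin 2} {z : ℂ}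
    (hf : f r = z • 1) : C f = 0 := by
  ext x
  obtain ⟨U, -, hx, S, a, hS, h⟩ := hC x
  rw [h _ x hx]
  refine Finset.sum_eq_zero fun α hα => ?_
  rw [Finset.prod_eq_zero (i := r) (Finset.mem_univ _), mul_zero]
  rw [hf, multiDeriv_const ((hS α hα).2 r)]
  rfl

end PolyDiff

namespace IsStarProduct

variable {p : PoissonBivector d} {c : ℕ → Cochain d 2}

theorem add_left (h : IsStarProduct p c) (k : ℕ) (f f' g : A d) :
    c k ![f + f', g] = c k ![f, g] + c k ![f', g] := by
  rcases Nat.eq_zero_or_pos k with rfl | hk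
  · simp only [h.zero, add_mul]
  · exact (h.polyDiff k hk).add_left f f' g

theorem add_right (h : IsStarProduct p c) (k : ℕ) (f g g' : A d) :
    c k ![f, g + g'] = c k ![f, g] + c k ![f, g'] := by
  rcases Nat.eq_zero_or_pos k with rfl | hk
  · simp only [h.zero, mul_add]
  · exact (h.polyDiff k hk).add_right f g g'

theorem zero_left (h : IsStarProduct p c) (k : ℕ) (g : A d) : c k ![0, g] = 0 := by
  have := h.add_left k 0 0 g
  rw [add_zero] at this
  exact left_eq_add.mp this

theorem zero_right (h : IsStarProduct p c) (k : ℕ) (f : A d) : c k ![f, 0] = 0 := by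
  have := h.add_right k f 0 0
  rw [add_zero] at this
  exact left_eq_add.mp this

theorem starMul_add_left (h : IsStarProduct p c) (F F' G : PowerSeries (A d)) :
    starMul c (F + F') G = starMul c F G + starMul c F' G := by
  ext1 n
  simp only [starMul, PowerSeries.coeff_mk, map_add, h.add_left, Finset.sum_add_distrib]

theorem starMul_add_right (h : IsStarProduct p c) (F G G' : PowerSeries (A d)) :
    starMul c F (G + G') = starMul c F G + starMul c F G' := by
  ext1 n
  simp only [starMul, PowerSeries.coeff_mk, map_add, h.add_right, Finset.sum_add_distrib]

/-- The `c_k` with `k ≥ 1` vanish on constants, so only `c_0` contributes. This yields the unit of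
the star algebra and the centrality of scalar series. -/
theorem starMul_const_left (h : IsStarProduct p c) {F : PowerSeries (A d)} {z : ℕ → ℂ}
    (hF : ∀ n, PowerSeries.coeff n F = z n • 1) (G : PowerSeries (A d)) :
    starMul c F G = F * G := by
  ext1 n
  rw [starMul, PowerSeries.coeff_mk, PowerSeries.coeff_mul,
    Finset.sum_eq_single (0, n)]
  · simp only [h.zero]
  · rintro ⟨k, s⟩ hks hne
    have hk : 1 ≤ k := by
      rw [Finset.HasAntidiagonal.mem_antidiagonal] at hks
      rw [Nat.one_le_iff_ne_zero]
      rintro rfl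
      exact hne (by simpa using hks)
    exact Finset.sum_eq_zero fun r _ => (h.polyDiff k hk).eq_zero_of_const (r := 0) (hF r.1)
  · simp

theorem starMul_const_right (h : IsStarProduct p c) {F : PowerSeries (A d)} {z : ℕ → ℂ}
    (hF : ∀ n, PowerSeries.coeff n F = z n • 1) (G : PowerSeries (A d)) :
    starMul c G F = F * G := by
  ext1 n
  rw [mul_comm, starMul, PowerSeries.coeff_mk, PowerSeries.coeff_mul,
    Finset.sum_eq_single (0, n)]
  · simp only [h.zero]
  · rintro ⟨k, s⟩ hks hne
    have hk : 1 ≤ k := by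
      rw [Finset.HasAntidiagonal.mem_antidiagonal] at hks
      rw [Nat.one_le_iff_ne_zero]
      rintro rfl
      exact hne (by simpa using hks)
    exact Finset.sum_eq_zero fun r _ => (h.polyDiff k hk).eq_zero_of_const (r := 1) (hF r.2)
  · simp

theorem coeff_one_eq_smul (n : ℕ) :
    PowerSeries.coeff n (1 : PowerSeries (A d)) = (if n = 0 then (1 : ℂ) else 0) • 1 := by
  rw [PowerSeries.coeff_one]
  split_ifs <;> simp

theorem coeff_zero_eq_smul (n : ℕ) :
    PowerSeries.coeff n (0 : PowerSeries (A d)) = (0 : ℕ → ℂ) n • 1 := by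
  simp

theorem starMul_C (h : IsStarProduct p c) (f g : A d) :
    starMul c (PowerSeries.C f) (PowerSeries.C g) = PowerSeries.mk fun n => c n ![f, g] := by
  ext1 n
  rw [starMul, PowerSeries.coeff_mk, PowerSeries.coeff_mk, Finset.sum_eq_single (n, 0)]
  · simp
  · rintro ⟨k, s⟩ hks hne
    have hs : s ≠ 0 := by
      rintro rfl
      exact hne (by simpa using hks)
    refine Finset.sum_eq_zero fun r hr => ?_
    rw [PowerSeries.coeff_C, PowerSeries.coeff_C]
    by_cases h1 : r.1 = 0
    · have h2 : r.2 ≠ 0 := by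
        rw [Finset.HasAntidiagonal.mem_antidiagonal] at hr
        simp only at hr
        omega
      rw [if_neg h2, h.zero_right]
    · rw [if_neg h1, h.zero_left]
  · simp

end IsStarProduct

/-- The power series over `A` with the star-product. -/
def StarAlgebra {p : PoissonBivector d} {c : ℕ → Cochain d 2} (_ : IsStarProduct p c) : Type :=
  PowerSeries (A d)

instance {p : PoissonBivector d} {c : ℕ → Cochain d 2} (h : IsStarProduct p c) :
    AddCommGroup (StarAlgebra h) :=
  inferInstanceAs (AddCommGroup (PowerSeries (A d)))

instance {p : PoissonBivector d} {c : ℕ → Cochain d 2} (h : IsStarProduct p c) :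
    Ring (StarAlgebra h) :=
  { (inferInstance : AddCommGroup (StarAlgebra h)) with
    mul := starMul c
    one := (1 : PowerSeries (A d))
    left_distrib := h.starMul_add_right
    right_distrib := h.starMul_add_left
    zero_mul := fun G => (h.starMul_const_left (z := 0) IsStarProduct.coeff_zero_eq_smul G).trans (zero_mul _)
    mul_zero := fun G => (h.starMul_const_right (z := 0) IsStarProduct.coeff_zero_eq_smul G).trans (zero_mul _)
    mul_assoc := h.assoc
    one_mul := fun G =>
      (h.starMul_const_left IsStarProduct.coeff_one_eq_smul G).trans (one_mul _)
    mul_one := fun G =>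
      (h.starMul_const_right IsStarProduct.coeff_one_eq_smul G).trans (one_mul _) }

end

/-! ### The noncommutative obstruction -/

section

/-- The obstruction to a flat symmetrized quantization of the Poisson bracket
`{x, y} = x²`, `{y, z} = x z`, `{z, x} = x y²`. -/
theorem two_mul_pow_eq_zero_of_commutators {R : Type*} [Ring R] {H X Y Z U V : R}
    (hcomm : ∀ r, r * H = H * r) (hcancel : ∀ r, H * r = 0 → r = 0)
    (hXY : X * Y - Y * X = H * (X * X)) (hYZ : Y * Z - Z * Y = H * U)
    (hZX : Z * X - X * Z = H * V) (hU : 2 * U = X * Z + Z * X)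
    (hV : 6 * V = (Y + X) ^ 3 - (Y - X) ^ 3 - 2 * X ^ 3) : 2 * X ^ 4 = 0 := by
  have hl (r s : R) : r * (H * s) = H * (r * s) := by
    rw [← mul_assoc, hcomm, mul_assoc]
  obtain ⟨S, hS⟩ : ∃ S, S = X * Y * Y + Y * X * Y + Y * Y * X := ⟨_, rfl⟩
  -- Polarization: the part of `(Y + X)³ - (Y - X)³` linear in `X` is `2 S`, and the cubic part is
  -- `2 X³`.
  have hVS : 6 * V = 2 * S := by rw [hV, hS]; noncomm_ring
  -- The Jacobi identity for commutators of `X, Y, Z`, divided by the central element `H`.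
  have hJ : X * U - U * X + (Y * V - V * Y) + (Z * X * X - X * X * Z) = 0 := by
    apply hcancel
    calc H * (X * U - U * X + (Y * V - V * Y) + (Z * X * X - X * X * Z))
        = X * (H * U) - H * U * X + (Y * (H * V) - H * V * Y) +
          (Z * (H * (X * X)) - H * (X * X) * Z) := by
          simp only [hl]
          noncomm_ring
      _ = 0 := by
          rw [← hXY, ← hYZ, ← hZX]
          noncomm_ring
  have hZXX : Z * X * X - X * X * Z = H * (V * X + X * V) := by
    calc Z * X * X - X * X * Z = (Z * X - X * Z) * X + X * (Z * X - X * Z) := by noncomm_ring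
      _ = _ := by rw [hZX, hl]; noncomm_ring
  -- Since `2 [X, U] = [X, XZ + ZX] = [X², Z]`, doubling `hJ` eliminates `Z` and leaves a relation
  -- in `X` and `Y` only.
  have hJ2 : H * (V * X + X * V) + 2 * (Y * V - V * Y) = 0 := by
    calc H * (V * X + X * V) + 2 * (Y * V - V * Y)
        = 2 * (X * U - U * X + (Y * V - V * Y) + (Z * X * X - X * X * Z)) -
          (X * (2 * U) - (2 * U) * X) + (X * X * Z - Z * X * X) := by
          rw [← hZXX]; noncomm_ring
      _ = 0 := by rw [hJ, hU]; noncomm_ring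
  have hYYY : X * Y * Y * Y - Y * Y * Y * X =
      H * (X * X * Y * Y + Y * X * X * Y + Y * Y * X * X) := by
    calc X * Y * Y * Y - Y * Y * Y * X = (X * Y - Y * X) * Y * Y + Y * ((X * Y - Y * X) * Y) +
          Y * Y * (X * Y - Y * X) := by noncomm_ring
      _ = _ := by
          rw [hXY]
          simp only [mul_assoc, hl, mul_add]
  have hS0 : 2 * (S * X + X * S - 2 * (X * X * Y * Y + Y * X * X * Y + Y * Y * X * X)) = 0 := by
    apply hcancel
    calc H * (2 * (S * X + X * S - 2 * (X * X * Y * Y + Y * X * X * Y + Y * Y * X * X)))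
        = H * (2 * S * X + X * (2 * S)) -
          4 * (H * (X * X * Y * Y + Y * X * X * Y + Y * Y * X * X)) := by noncomm_ring
      _ = H * (2 * S * X + X * (2 * S)) + 2 * (Y * (2 * S) - 2 * S * Y) := by
          rw [← hYYY, hS]; noncomm_ring
      _ = 6 * (H * (V * X + X * V) + 2 * (Y * V - V * Y)) := by
          rw [← hVS]; noncomm_ring
      _ = 0 := by rw [hJ2, mul_zero]
  have hXXX : X * X * X * Y - Y * X * X * X = 3 * (H * (X * X * X * X)) := by
    calc X * X * X * Y - Y * X * X * X = X * (X * (X * Y - Y * X)) + X * ((X * Y - Y * X) * X) +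
          (X * Y - Y * X) * X * X := by noncomm_ring
      _ = _ := by
          rw [hXY]
          simp only [mul_assoc, hl]
          noncomm_ring
  -- Both groups contain six words with two `Y`s, so they cancel classically. Reordering by `[X, Y]
  -- = H X²` leaves `H [X³, Y] - 2 H² X⁴`, and `[X³, Y] = 3 H X⁴`.
  have hD : S * X + X * S - 2 * (X * X * Y * Y + Y * X * X * Y + Y * Y * X * X) =
      H * (H * X ^ 4) := by
    calc S * X + X * S - 2 * (X * X * Y * Y + Y * X * X * Y + Y * Y * X * X)
        = -(X * (X * Y - Y * X) * Y) + Y * (X * Y - Y * X) * X - 2 * (Y * X * (X * Y - Y * X)) +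
          2 * ((X * Y - Y * X) * X * Y) - 2 * ((X * Y - Y * X) * (X * Y - Y * X)) := by
          rw [hS]; noncomm_ring
      _ = H * (X * X * X * Y - Y * X * X * X) - 2 * (H * (H * (X * X * X * X))) := by
          rw [hXY]
          simp only [mul_assoc, hl]
          noncomm_ring
      _ = _ := by rw [hXXX]; noncomm_ring
  refine hcancel _ (hcancel _ ?_)
  rw [← hS0, hD]
  noncomm_ring

end

/-! ### The Poisson bivector that detects wheels -/

section

variable {d : ℕ}

/-- Matrix of the bivector on `ℝ^d` with components `P, Q, S` along `∂_v ∧ ∂_w`, `∂_w ∧ ∂_u`, `∂_u ∧ ∂_v`. -/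
def tripleMatrix {R : Type*} [CommRing R] (u v w : Fin d) (P Q S : R) (i j : Fin d) : R :=
  let δ : Fin d → Fin d → R := fun k l => if l = k then 1 else 0
  P * (δ v i * δ w j - δ w i * δ v j) + Q * (δ w i * δ u j - δ u i * δ w j) +
    S * (δ u i * δ v j - δ v i * δ u j)

theorem sum_tripleMatrix {R : Type*} [CommRing R] (u v w : Fin d) (P Q S : R) (a b : Fin d → R) :
    ∑ i, ∑ j, tripleMatrix u v w P Q S i j * a i * b j =
      P * (a v * b w - a w * b v) + Q * (a w * b u - a u * b w) + S * (a u * b v - a v * b u) := by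
  have h (k l : Fin d) : ∑ i, ∑ j, (if i = k then (1 : R) else 0) * (if j = l then 1 else 0) *
      (a i * b j) = a k * b l := by
    simp
  have key : ∑ i, ∑ j, tripleMatrix u v w P Q S i j * a i * b j =
      P * (∑ i, ∑ j, (if i = v then (1 : R) else 0) * (if j = w then 1 else 0) * (a i * b j) -
        ∑ i, ∑ j, (if i = w then (1 : R) else 0) * (if j = v then 1 else 0) * (a i * b j)) +
      Q * (∑ i, ∑ j, (if i = w then (1 : R) else 0) * (if j = u then 1 else 0) * (a i * b j) -
        ∑ i, ∑ j, (if i = u then (1 : R) else 0) * (if j = w then 1 else 0) * (a i * b j)) +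
      S * (∑ i, ∑ j, (if i = u then (1 : R) else 0) * (if j = v then 1 else 0) * (a i * b j) -
        ∑ i, ∑ j, (if i = v then (1 : R) else 0) * (if j = u then 1 else 0) * (a i * b j)) := by
    simp only [Finset.mul_sum, ← Finset.sum_sub_distrib, ← Finset.sum_add_distrib]
    refine Finset.sum_congr rfl fun i _ => Finset.sum_congr rfl fun j _ => ?_
    simp only [tripleMatrix]
    ring
  rw [key]
  simp only [h]

/-- The bracket `{x, y} = x²`, `{y, z} = x z`, `{z, x} = x y²` satisfies the Jacobi identity. -/
theorem jacobi_of_commuting_derivations {R : Type*} [CommRing R] (D₀ D₁ D₂ : R →+ R)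
    (h₀ : ∀ f g, D₀ (f * g) = D₀ f * g + f * D₀ g) (h₁ : ∀ f g, D₁ (f * g) = D₁ f * g + f * D₁ g)
    (h₂ : ∀ f g, D₂ (f * g) = D₂ f * g + f * D₂ g)
    (h₀₁ : ∀ f, D₁ (D₀ f) = D₀ (D₁ f)) (h₀₂ : ∀ f, D₂ (D₀ f) = D₀ (D₂ f))
    (h₁₂ : ∀ f, D₂ (D₁ f) = D₁ (D₂ f)) {x y z : R}
    (hx₀ : D₀ x = 1) (hx₁ : D₁ x = 0) (hx₂ : D₂ x = 0)
    (hy₀ : D₀ y = 0) (hy₁ : D₁ y = 1) (hy₂ : D₂ y = 0)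
    (hz₀ : D₀ z = 0) (hz₁ : D₁ z = 0) (hz₂ : D₂ z = 1) (P : R → R → R)
    (hP : ∀ f g, P f g = x * z * (D₁ f * D₂ g - D₂ f * D₁ g) +
      x * (y * y) * (D₂ f * D₀ g - D₀ f * D₂ g) + x * x * (D₀ f * D₁ g - D₁ f * D₀ g))
    (f g h : R) : P f (P g h) + P g (P h f) + P h (P f g) = 0 := by
  simp only [hP, map_add, map_sub, h₀, h₁, h₂, h₀₁, h₀₂, h₁₂, hx₀, hx₁, hx₂, hy₀, hy₁, hy₂,
    hz₀, hz₁, hz₂]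
  ring

/-- Components of the bracket `{x, y} = x²`, `{y, z} = x z`, `{z, x} = x y²` in the coordinates
`x = x_u`, `y = x_v`, `z = x_w`. -/
def wheelDetectingComp (u v w : Fin d) (i j : Fin d) (x : Fin d → ℝ) : ℝ :=
  tripleMatrix u v w (x u * x w) (x u * (x v * x v)) (x u * x u) i j

theorem contDiff_wheelDetectingComp (u v w i j : Fin d) :
    ContDiff ℝ ∞ (wheelDetectingComp u v w i j) := by
  unfold wheelDetectingComp tripleMatrix
  fun_prop

theorem ofRealFun_wheelDetectingComp (u v w i j : Fin d) :
    ofRealFun (wheelDetectingComp u v w i j) (contDiff_wheelDetectingComp u v w i j) =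
      tripleMatrix u v w (coordFn u * coordFn w) (coordFn u * (coordFn v * coordFn v))
        (coordFn u * coordFn u : A d) i j := by
  ext x
  have hδ (k l : Fin d) : (((if l = k then 1 else 0 : A d)).1 x : ℂ) =
      (((if l = k then 1 else 0 : ℝ)) : ℂ) := by
    split_ifs <;> simp
  change ((wheelDetectingComp u v w i j x : ℝ) : ℂ) =
    ((x u : ℂ) * x w) * (_ * _ - _ * _) + ((x u : ℂ) * (x v * x v)) * (_ * _ - _ * _) +
      ((x u : ℂ) * x u) * (_ * _ - _ * _)
  simp only [hδ]
  simp only [wheelDetectingComp, tripleMatrix]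
  push_cast
  ring

theorem bracket_tripleMatrix (u v w : Fin d) (P Q S : A d) (f g : A d) :
    bracket (tripleMatrix u v w P Q S) f g =
      P * (pderiv v f * pderiv w g - pderiv w f * pderiv v g) +
      Q * (pderiv w f * pderiv u g - pderiv u f * pderiv w g) +
      S * (pderiv u f * pderiv v g - pderiv v f * pderiv u g) :=
  sum_tripleMatrix u v w P Q S (fun i => pderiv i f) (fun i => pderiv i g)

/-- The Poisson bivector with `{x, y} = x²`, `{y, z} = x z`, `{z, x} = x y²` in the coordinates
`x = x_u`, `y = x_v`, `z = x_w`. -/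
def wheelDetecting {u v w : Fin d} (huv : u ≠ v) (huw : u ≠ w) (hvw : v ≠ w) :
    PoissonBivector d where
  comp := wheelDetectingComp u v w
  smooth := contDiff_wheelDetectingComp u v w
  antisymm i j x := by
    simp only [wheelDetectingComp, tripleMatrix]
    ring
  jacobi f g h := by
    simp only [ofRealFun_wheelDetectingComp]
    exact jacobi_of_commuting_derivations (pderivₗ u).toAddMonoidHom (pderivₗ v).toAddMonoidHom
      (pderivₗ w).toAddMonoidHom (pderiv_mul u) (pderiv_mul v) (pderiv_mul w)
      (pderiv_comm v u) (pderiv_comm w u) (pderiv_comm w v)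
      ((pderiv_coordFn u u).trans (if_pos rfl)) ((pderiv_coordFn v u).trans (if_neg huv.symm))
      ((pderiv_coordFn w u).trans (if_neg huw.symm)) ((pderiv_coordFn u v).trans (if_neg huv))
      ((pderiv_coordFn v v).trans (if_pos rfl)) ((pderiv_coordFn w v).trans (if_neg hvw.symm))
      ((pderiv_coordFn u w).trans (if_neg huw)) ((pderiv_coordFn v w).trans (if_neg hvw))
      ((pderiv_coordFn w w).trans (if_pos rfl)) _
      (fun f g => bracket_tripleMatrix u v w _ _ _ f g) f g h

/-! ### Commutators and powers in a wheel-free star-product -/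

section Commutators

variable {p : PoissonBivector d} {c : ℕ → Cochain d 2}

/-- A star-product without wheels, as far as it is seen on functions of one linear form and on
coordinate functions. -/
structure IsWheelFreeLike (p : PoissonBivector d) (c : ℕ → Cochain d 2) : Prop where
  jet : ∀ k, 1 ≤ k → ∀ (b : Fin d → ℂ) (F : Fin 2 → ℕ → A d), (∀ w, IsJetAlong b (F w)) →
    c k (fun w => F w 0) = 0
  coordFn : ∀ k, 1 ≤ k → ∃ r : ℂ, ∀ i j,
    c k ![UniversalQuantization.coordFn i, UniversalQuantization.coordFn j] = r • p.coord i j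

theorem isWheelFreeLike_of_graphSum
    (h : ∀ k, 1 ≤ k → ∃ a : (Σ n, KGraph n 2) →₀ ℝ,
      c k = graphSum p a ∧ ∀ Γ ∈ a.support, ¬ Γ.2.HasWheel) : IsWheelFreeLike p c where
  jet k hk b F hF := by
    obtain ⟨a, hc, ha⟩ := h k hk
    rw [hc, graphSum_jet_eq_zero p ha hF]
  coordFn k hk := by
    obtain ⟨a, hc, ha⟩ := h k hk
    obtain ⟨r, hr⟩ := exists_graphSum_coordFn p ha
    exact ⟨r, by rwa [hc]⟩

namespace StarAlgebra

/-- A function as a constant power series. -/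
def C (h : IsStarProduct p c) (f : A d) : StarAlgebra h := (PowerSeries.C f : PowerSeries (A d))

theorem C_add (h : IsStarProduct p c) (f g : A d) : C h (f + g) = C h f + C h g :=
  map_add (PowerSeries.C (R := A d)) f g

theorem C_sub (h : IsStarProduct p c) (f g : A d) : C h (f - g) = C h f - C h g :=
  map_sub (PowerSeries.C (R := A d)) f g

/-- Both factors are functions of the same linear form, so all corrections `c_k` with `k ≥ 1` vanish
on them. -/
theorem C_mul_C_of_linear (h : IsStarProduct p c) (hw : IsWheelFreeLike p c) {b : Fin d → ℂ}
    {l : A d} (hl : ∀ i, pderiv i l = b i • (1 : A d)) (m n : ℕ) :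
    C h (l ^ m) * C h (l ^ n) = C h (l ^ (m + n)) := by
  change starMul c (PowerSeries.C _) (PowerSeries.C _) = PowerSeries.C _
  rw [h.starMul_C]
  ext1 k
  rw [PowerSeries.coeff_mk, PowerSeries.coeff_C]
  rcases Nat.eq_zero_or_pos k with rfl | hk
  · rw [h.zero, if_pos rfl, pow_add]
  · rw [if_neg hk.ne']
    have := hw.jet k hk b (fun s n' => ((![m, n] s).descFactorial n' : ℂ) • l ^ (![m, n] s - n'))
      fun s => isJetAlong_pow hl _
    convert this using 2
    ext s
    fin_cases s <;> simp

theorem C_pow_of_linear (h : IsStarProduct p c) (hw : IsWheelFreeLike p c) {b : Fin d → ℂ}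
    {l : A d} (hl : ∀ i, pderiv i l = b i • (1 : A d)) (m : ℕ) :
    C h l ^ m = C h (l ^ m) := by
  induction m with
  | zero => rw [pow_zero, pow_zero]; rfl
  | succ m ih =>
    have := C_mul_C_of_linear h hw hl m 1
    rw [pow_one] at this
    rw [pow_succ, ih, this]

/-- With `c_k(x_i, x_j) = r_k 𝔭^{ij}` for `k ≥ 1`, antisymmetry of `𝔭` doubles the corrections in
the commutator and cancels them in the anticommutator. So `H = ∑ 2 r_k ħ^k` works. -/
theorem exists_commutator (h : IsStarProduct p c) (hw : IsWheelFreeLike p c)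
    (hp : ∃ i j, bracket p.coord (coordFn i) (coordFn j) ≠ 0)
    (hb : ∀ i j, bracket p.coord (coordFn i) (coordFn j) = p.coord i j) :
    ∃ H : StarAlgebra h, (∀ r, r * H = H * r) ∧ (∀ r, H * r = 0 → r = 0) ∧
      (∀ i j, C h (coordFn i) * C h (coordFn j) - C h (coordFn j) * C h (coordFn i) =
        H * C h (p.coord i j)) ∧
      ∀ i j, C h (coordFn i) * C h (coordFn j) + C h (coordFn j) * C h (coordFn i) =
        2 * C h (coordFn i * coordFn j) := by
  choose! r hr using hw.coordFn
  -- The direction of the star-product fixes `r 1`, because some `𝔭^{ij}` is nonzero. This makes the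
  -- leading coefficient of `H` invertible.
  have hr1 : r 1 = 1 := by
    obtain ⟨i, j, hij⟩ := hp
    have h1 := h.antisymm (coordFn i) (coordFn j)
    rw [hb] at h1 hij
    rw [hr 1 le_rfl, hr 1 le_rfl, p.coord_swap i j] at h1
    obtain ⟨x, hx⟩ : ∃ x, (p.coord i j).1 x ≠ 0 := by
      by_contra! hx
      exact hij (Subtype.ext (funext hx))
    have h2 : (1 / 2 : ℂ) * (r 1 * (p.coord i j).1 x - r 1 * -(p.coord i j).1 x) =
      (p.coord i j).1 x := congrArg (fun f : A d => f.1 x) h1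
    refine mul_right_cancel₀ hx ?_
    linear_combination h2
  let z : ℕ → ℂ := fun k => if k = 0 then 0 else 2 * r k
  let H : PowerSeries (A d) := PowerSeries.mk fun k => z k • 1
  have hH (n : ℕ) : PowerSeries.coeff n H = z n • 1 := PowerSeries.coeff_mk _ _
  have hl (F : PowerSeries (A d)) : starMul c H F = H * F := h.starMul_const_left hH F
  have hmul (i j : Fin d) (k : ℕ) : PowerSeries.coeff k
      (starMul c (PowerSeries.C (coordFn i)) (PowerSeries.C (coordFn j))) =
      if k = 0 then coordFn i * coordFn j else r k • p.coord i j := by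
    rw [h.starMul_C, PowerSeries.coeff_mk]
    split_ifs with hk
    · rw [hk, h.zero]
    · rw [hr k (Nat.one_le_iff_ne_zero.mpr hk)]
  have hcancel (F : PowerSeries (A d)) (hF : starMul c H F = 0) : F = 0 := by
    rw [hl] at hF
    -- `H` is `ħ` times a series with constant term `2`, a unit, so cancelling `H` amounts to
    -- cancelling `ħ`.
    have hX : H = PowerSeries.X * PowerSeries.mk fun k => z (k + 1) • (1 : A d) := by
      ext1 k
      cases k with
      | zero => simp [hH, z]
      | succ k => rw [PowerSeries.coeff_succ_X_mul, hH, PowerSeries.coeff_mk]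
    have hu : IsUnit (PowerSeries.mk fun k => z (k + 1) • (1 : A d)) := by
      rw [PowerSeries.isUnit_iff_constantCoeff, ← PowerSeries.coeff_zero_eq_constantCoeff_apply,
        PowerSeries.coeff_mk]
      refine IsUnit.of_mul_eq_one ((1 / 2 : ℂ) • 1) ?_
      simp [z, hr1]
    rw [hX, mul_comm PowerSeries.X, mul_assoc] at hF
    have hF' := hu.mul_right_eq_zero.mp hF
    ext1 k
    rw [← PowerSeries.coeff_succ_X_mul, hF', map_zero, map_zero]
  have hbr (i j : Fin d) : starMul c (PowerSeries.C (coordFn i)) (PowerSeries.C (coordFn j)) -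
      starMul c (PowerSeries.C (coordFn j)) (PowerSeries.C (coordFn i)) =
      starMul c H (PowerSeries.C (p.coord i j)) := by
    ext1 k
    rw [hl, map_sub, hmul, hmul, PowerSeries.coeff_mul_C, hH]
    by_cases hk : k = 0
    · simp [hk, z, mul_comm]
    · have h2 : (2 * r k) • (1 : A d) * p.coord i j = r k • p.coord i j + r k • p.coord i j := by
        rw [smul_mul_assoc, one_mul, mul_smul, two_smul]
      simp only [hk, if_false, z, p.coord_swap i j, A.smul_neg, h2]
      ring
  have hsym (i j : Fin d) : starMul c (PowerSeries.C (coordFn i)) (PowerSeries.C (coordFn j)) +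
      starMul c (PowerSeries.C (coordFn j)) (PowerSeries.C (coordFn i)) =
      PowerSeries.C (coordFn i * coordFn j) + PowerSeries.C (coordFn i * coordFn j) := by
    ext1 k
    rw [map_add, map_add, hmul, hmul, PowerSeries.coeff_C]
    by_cases hk : k = 0
    · simp [hk, mul_comm]
    · simp only [hk, if_false, p.coord_swap i j, A.smul_neg]
      ring
  exact ⟨H, fun F => (h.starMul_const_right hH F).trans (hl F).symm, hcancel, hbr,
    fun i j => (hsym i j).trans (two_mul (C h (coordFn i * coordFn j))).symm⟩

end StarAlgebra

end Commutators

/-! ### The contradiction for this bivector -/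

theorem wheelDetecting_coord {u v w : Fin d} (huv : u ≠ v) (huw : u ≠ w) (hvw : v ≠ w) :
    (wheelDetecting huv huw hvw).coord =
      tripleMatrix u v w (coordFn u * coordFn w) (coordFn u * (coordFn v * coordFn v))
        (coordFn u * coordFn u : A d) :=
  funext fun i => funext fun j => ofRealFun_wheelDetectingComp u v w i j

theorem bracket_coordFn (π : Fin d → Fin d → A d) (i j : Fin d) :
    bracket π (coordFn i) (coordFn j) = π i j := by
  simp [bracket, pderiv_coordFn]

theorem not_isWheelFreeLike {u v w : Fin d} (huv : u ≠ v) (huw : u ≠ w) (hvw : v ≠ w)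
    {c : ℕ → Cochain d 2} (h : IsStarProduct (wheelDetecting huv huw hvw) c) :
    ¬ IsWheelFreeLike (wheelDetecting huv huw hvw) c := by
  intro hw
  have huv' : (wheelDetecting huv huw hvw).coord u v = coordFn u * coordFn u := by
    rw [wheelDetecting_coord]
    simp [tripleMatrix, huv, huw, hvw, huv.symm]
  have hvw' : (wheelDetecting huv huw hvw).coord v w = coordFn u * coordFn w := by
    rw [wheelDetecting_coord]
    simp [tripleMatrix, hvw, huv.symm, huw.symm, hvw.symm]
  have hwu' : (wheelDetecting huv huw hvw).coord w u = coordFn u * (coordFn v * coordFn v) := by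
    rw [wheelDetecting_coord]
    simp [tripleMatrix, huv, huw, huw.symm, hvw.symm]
  have hne (m : ℕ) : (coordFn u : A d) ^ m ≠ 0 := by
    intro h0
    have := congrArg (fun f : A d => f.1 1) h0
    simp [coordFn_apply] at this
  obtain ⟨H, hcomm, hcancel, hbr, hsym⟩ := StarAlgebra.exists_commutator h hw
    ⟨u, v, by rw [bracket_coordFn, huv', ← pow_two]; exact hne 2⟩
    (fun i j => bracket_coordFn _ i j)
  have hlin (i : Fin d) (k : Fin d) :
      pderiv k (coordFn i) = (if k = i then (1 : ℂ) else 0) • (1 : A d) := by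
    rw [pderiv_coordFn]; split_ifs <;> simp
  have hlin_add (k : Fin d) : pderiv k (coordFn v + coordFn u) =
      ((if k = v then (1 : ℂ) else 0) + (if k = u then (1 : ℂ) else 0)) • (1 : A d) := by
    rw [pderiv_add, hlin, hlin, add_smul]
  have hlin_sub (k : Fin d) : pderiv k (coordFn v - coordFn u) =
      ((if k = v then (1 : ℂ) else 0) + (-1) * (if k = u then (1 : ℂ) else 0)) • (1 : A d) := by
    have : (coordFn v - coordFn u : A d) = coordFn v + (-1 : ℂ) • coordFn u := by
      ext x; simp [sub_eq_add_neg]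
    rw [this, pderiv_add, pderiv_smul, hlin, hlin, add_smul, smul_smul]
  have h4 := two_mul_pow_eq_zero_of_commutators (Z := StarAlgebra.C h (coordFn w)) hcomm hcancel
    (X := StarAlgebra.C h (coordFn u)) (Y := StarAlgebra.C h (coordFn v))
    (U := StarAlgebra.C h (coordFn u * coordFn w))
    (V := StarAlgebra.C h (coordFn u * (coordFn v * coordFn v))) ?_ ?_ ?_ ?_ ?_
  -- The fourth star power of `x` is the function `x⁴`, so the obstruction becomes the false
  -- identity `2 x⁴ = 0` in `A`.
  · rw [StarAlgebra.C_pow_of_linear h hw (hlin u), two_mul, ← StarAlgebra.C_add] at h4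
    have h5 : (coordFn u : A d) ^ 4 + coordFn u ^ 4 = 0 :=
      PowerSeries.C_injective (h4.trans (map_zero PowerSeries.C).symm)
    refine hne 4 ?_
    ext x
    exact self_eq_neg.mp (eq_neg_of_add_eq_zero_left (congrArg (fun f : A d => f.1 x) h5))
  · have := StarAlgebra.C_pow_of_linear h hw (hlin u) 2
    rw [pow_two, pow_two] at this
    rw [hbr, huv', this]
  · rw [hbr, hvw']
  · rw [hbr, hwu']
  · exact (hsym u w).symm
  -- The cubes of the linear forms `y + x`, `y - x` and `x` are ordinary cubes, which reduces the
  -- claim to `6xy² = (y + x)³ - (y - x)³ - 2x³` in `A`.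
  · rw [← StarAlgebra.C_add, ← StarAlgebra.C_sub, StarAlgebra.C_pow_of_linear h hw hlin_add,
      StarAlgebra.C_pow_of_linear h hw hlin_sub, StarAlgebra.C_pow_of_linear h hw (hlin u), two_mul,
      ← StarAlgebra.C_add, ← StarAlgebra.C_sub, ← StarAlgebra.C_sub]
    have h6 (F : StarAlgebra h) : 6 * F = F + F + F + F + F + F := by noncomm_ring
    rw [h6]
    simp only [← StarAlgebra.C_add]
    congr 1
    ring

end

end UniversalQuantization

end

theorem theorem4p1 (d : ℕ) (hd : 3 ≤ d)
    (Q : UniversalQuantization.UniversalQuantizationFormula d) :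
    ∃ (p : UniversalQuantization.PoissonBivector d) (k : ℕ), 1 ≤ k ∧
      ∀ a : (Σ n, UniversalQuantization.KGraph n 2) →₀ ℝ,
        Q.c p k = UniversalQuantization.graphSum p a → ∃ Γ ∈ a.support, Γ.2.HasWheel := by
  have huv : (⟨0, by omega⟩ : Fin d) ≠ ⟨1, by omega⟩ := by simp
  have huw : (⟨0, by omega⟩ : Fin d) ≠ ⟨2, by omega⟩ := by simp
  have hvw : (⟨1, by omega⟩ : Fin d) ≠ ⟨2, by omega⟩ := by simp
  refine ⟨UniversalQuantization.wheelDetecting huv huw hvw, ?_⟩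
  by_contra! h
  exact UniversalQuantization.not_isWheelFreeLike huv huw hvw (Q.isStarProduct _)
    (UniversalQuantization.isWheelFreeLike_of_graphSum h)
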